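/- Let $0<q<1$ and let $\alpha,\beta>1$ be real with $0<\alpha q<1$ and $0<\beta q<1$. Let $N\in\mathbb N_0$ and $n\in\{0,1,\dots,N\}$; if $n=2$, assume in addition that $\alpha\beta q<1$ (for $n\ge 3$ no such condition is needed). For parameters $a,b$ and a complex variable $\bar x$ let $$\tilde Q_n(\bar x;a,b,N|q)=\frac{(aq;q)_n\,(q^{-N};q)_n}{(abq^{n+1};q)_n}\;{}_3\phi_2\!\left(\begin{matrix}q^{-n},\ abq^{n+1},\ \bar x\\ aq,\ q^{-N}\end{matrix}\,;\,q;q\right) =\frac{(aq;q)_n\,(q^{-N};q)_n}{(abq^{n+1};q)_n}\sum_{m=0}^{n}\frac{(q^{-n};q)_m\,(abq^{n+1};q)_m\,(\bar x;q)_m}{(aq;q)_m\,(q^{-N};q)_m\,(q;q)_m}\,q^m$$ be the $q$-Hahn polynomial, where $(c;q)_m=\prod_{j=0}^{m-1}(1-cq^j)$. Then $\tilde Q_n\big(\bar x;\tfrac{\alpha}{q},\tfrac{\beta}{q},N|q\big)$ is a monic polynomial of degree $n$ in $\bar x$, and all its $n$ zeros in $\mathbb C$ are real and distinct (hence simple).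 If $n\ge 2$ and $z_{n,1}<z_{n,2}<\dots<z_{n,n}$ are these zeros, then $$z_{n,1}<1\qquad\text{and}\qquad q^{-N}<z_{n,n}.$$ -/

import Mathlib

/-- The `q`-Pochhammer symbol `(a; q)_m = ∏_{j < m} (1 - a q^j)`. -/
noncomputable def qPochhammer (a q : ℂ) (m : ℕ) : ℂ :=
  ∏ j ∈ Finset.range m, (1 - a * q ^ j)

/-- The multi-parameter symbol `(a₁, …, a_r; q)_m = (a₁; q)_m ⋯ (a_r; q)_m`. -/
noncomputable def qPochhammerList (as : List ℂ) (q : ℂ) (m : ℕ) : ℂ :=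
  (as.map fun a => qPochhammer a q m).prod

/-- The basic hypergeometric series `_rφ_s(a₁, …, a_r; b₁, …, b_s; q, z)`.
If `q^{-n}` is an upper parameter, all terms with `m > n` vanish and the sum is finite.  This
includes the terms in which a lower parameter `q^{-N}`, `N ≥ n`, produces a quotient `0 / 0`: these
have `m > N`, lie beyond the point of termination, and are `0` here, as usual. -/
noncomputable def basicHypergeometric (as bs : List ℂ) (q z : ℂ) : ℂ :=
  ∑' m : ℕ, qPochhammerList as q m / qPochhammerList bs q m
    * ((-1) ^ m * q ^ (m.choose 2)) ^ (1 + (bs.length : ℤ) - (as.length : ℤ))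
    * (z ^ m / qPochhammer q q m)

/-- The monic `q`-Hahn polynomial `Q̃_n(x; α, β, N | q)`, as a function of the complex variable
`x` (the variable written `q^{-x}` on the lattice). -/
noncomputable def qHahn (q α β : ℂ) (N n : ℕ) (x : ℂ) : ℂ :=
  qPochhammer (α * q) q n * qPochhammer (q ^ (-(N : ℤ))) q n
      / qPochhammer (α * β * q * q ^ n) q n
    * basicHypergeometric [q ^ (-(n : ℤ)), α * β * q ^ (n + 1), x] [α * q, q ^ (-(N : ℤ))] q q

open Finset Polynomial

/-! The polynomial is orthogonal to lower degrees for a discrete weight on the nodes `q^{-i}`, `0 ≤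
i ≤ N`. Since `1 < α, β` and `αq, βq < 1`, this weight is positive at the inner nodes and negative
at the two end nodes `1` and `q^{-N}`. Test polynomials divisible by `(x - 1)(x - q^{-N})` do not
see the end nodes, so the usual sign-change argument still yields `n - 2` distinct zeros strictly
between them. The remaining two come from the values at the end nodes: the sum collapses at `1` and
is `q`-Chu–Vandermonde at `q^{-N}`, and both values have the sign that forces a zero outside, by the
intermediate value theorem.

Orthogonality (`sum_weight_mul_qHahnPoly_eval`) is tested on the basis `(β q^N x; q)_k`, for which
the moments of `(x; q)_m` are products (`sum_weight_mul_qPoch`), so that `sum_qCoeff_mul_qPoch` sums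
the expansion. The root count is `Polynomial.Monic.exists_finset_roots_of_orthogonal`. The condition
on `αβq` enters through `αβq^{n-1} < 1`, which is automatic for `n ≥ 3`. -/

/-- The `q`-Pochhammer symbol over an arbitrary commutative ring. -/
def qPoch {R : Type*} [CommRing R] (a q : R) (m : ℕ) : R :=
  ∏ j ∈ range m, (1 - a * q ^ j)

/-! ### Recurrences for the `q`-Pochhammer symbol -/

section CommRing

variable {R : Type*} [CommRing R]

@[simp] theorem qPoch_zero (a q : R) : qPoch a q 0 = 1 := by simp [qPoch]

theorem qPoch_succ (a q : R) (m : ℕ) : qPoch a q (m + 1) = qPoch a q m * (1 - a * q ^ m) := by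
  simp [qPoch, prod_range_succ]

theorem qPoch_succ' (a q : R) (m : ℕ) : qPoch a q (m + 1) = (1 - a) * qPoch (a * q) q m := by
  rw [qPoch, prod_range_succ', qPoch, mul_comm]
  simp [pow_succ', mul_assoc]

theorem qPoch_add (a q : R) (m k : ℕ) :
    qPoch a q (m + k) = qPoch a q m * qPoch (a * q ^ m) q k := by
  simp [qPoch, prod_range_add, pow_add, mul_assoc]

end CommRing

/-! ### Terminating `q`-Chu–Vandermonde sums -/

section Field

variable {K : Type*} [Field K]

/-- `q`-analogue of the signed binomial coefficient `(-1)^m * n.choose m`, the coefficient in the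
terminating `q`-Chu–Vandermonde sum. -/
def qCoeff (q : K) (n m : ℕ) : K :=
  qPoch (q ^ n)⁻¹ q m * q ^ m / qPoch q q m

theorem qPoch_inv_pow_eq_zero {q : K} (hq : q ≠ 0) {n m : ℕ} (h : n < m) :
    qPoch (q ^ n)⁻¹ q m = 0 := by
  refine prod_eq_zero (mem_range.2 h) ?_
  rw [inv_mul_cancel₀ (pow_ne_zero _ hq), sub_self]

theorem qCoeff_zero_right (q : K) (n : ℕ) : qCoeff q n 0 = 1 := by simp [qCoeff]

/-- The `q`-Pascal rule that drives the induction for the Chu–Vandermonde sum. -/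
theorem qCoeff_succ_succ {q : K} (hq : q ≠ 0) (hne : ∀ k, qPoch q q k ≠ 0) (n m : ℕ) :
    qCoeff q (n + 1) (m + 1) = qCoeff q n (m + 1) - (q ^ n)⁻¹ * qCoeff q n m := by
  have h1 := hne m
  have h2 := hne (m + 1)
  have h3 : (1 - q * q ^ m) ≠ 0 := by
    intro h; apply h2; rw [qPoch_succ, h, mul_zero]
  have h4 : (q ^ (n + 1))⁻¹ * q = (q ^ n)⁻¹ := by rw [pow_succ]; field_simp
  simp only [qCoeff]
  rw [qPoch_succ' (q ^ (n + 1))⁻¹, h4, qPoch_succ (q ^ n)⁻¹, qPoch_succ q]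
  field_simp
  ring

/-- The terminating `q`-Chu–Vandermonde sum, cleared of denominators. -/
theorem sum_qCoeff_mul_qPoch {q : K} (hq : q ≠ 0) (hne : ∀ k, qPoch q q k ≠ 0) (n : ℕ) (B C : K) :
    ∑ m ∈ range (n + 1), qCoeff q n m * qPoch B q m * qPoch (C * q ^ m) q (n - m)
      = ∏ j ∈ range n, (B - C * q ^ j) := by
  induction n generalizing B C with
  | zero => simp [qCoeff]
  | succ n ih =>
    -- The extra last factor of `(C q^m; q)_{n+1-m}` is `1 - C q^n`, independent of `m`.
    have e1 : ∑ m ∈ range (n + 1 + 1),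
        qCoeff q n m * qPoch B q m * qPoch (C * q ^ m) q (n + 1 - m)
          = (1 - C * q ^ n) * ∏ j ∈ range n, (B - C * q ^ j) := by
      rw [sum_range_succ, ← ih, mul_sum]
      have : qCoeff q n (n + 1) = 0 := by
        simp [qCoeff, qPoch_inv_pow_eq_zero hq (Nat.lt_succ_self n)]
      rw [this, zero_mul, zero_mul, add_zero]
      refine sum_congr rfl fun m hm => ?_
      obtain ⟨k, rfl⟩ := Nat.exists_eq_add_of_le (Nat.lt_succ_iff.1 (mem_range.1 hm))
      rw [show m + k + 1 - m = k + 1 by omega, show m + k - m = k by omega, qPoch_succ]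
      ring
    have e2 : ∑ m ∈ range (n + 1),
        (q ^ n)⁻¹ * qCoeff q n m * qPoch B q (m + 1) * qPoch (C * q ^ (m + 1)) q (n - m)
          = (1 - B) * ∏ j ∈ range n, (B - C * q ^ j) := by
      -- Splitting `1 - B` off `(B; q)_{m+1}` leaves the sum for `n` with both parameters multiplied
      -- by `q`.
      have h := ih (B * q) (C * q)
      have h' : ∏ j ∈ range n, (B * q - C * q * q ^ j)
          = q ^ n * ∏ j ∈ range n, (B - C * q ^ j) := by
        rw [← card_range n, ← prod_const, card_range, ← prod_mul_distrib]
        exact prod_congr rfl fun j _ => by ring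
      have hqn := pow_ne_zero n hq
      rw [h'] at h
      rw [show (1 - B) * ∏ j ∈ range n, (B - C * q ^ j)
        = (1 - B) * (q ^ n)⁻¹ * (q ^ n * ∏ j ∈ range n, (B - C * q ^ j)) by field_simp, ← h, mul_sum]
      refine sum_congr rfl fun m _ => ?_
      rw [qPoch_succ', show C * q * q ^ m = C * q ^ (m + 1) by ring]
      ring
    rw [prod_range_succ, show (∏ j ∈ range n, (B - C * q ^ j)) * (B - C * q ^ n)
      = (1 - C * q ^ n) * ∏ j ∈ range n, (B - C * q ^ j)
        - (1 - B) * ∏ j ∈ range n, (B - C * q ^ j) by ring, ← e1, ← e2,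
      sum_range_succ', sum_range_succ' _ (n + 1), add_sub_right_comm, ← sum_sub_distrib]
    congr 1
    refine sum_congr rfl fun m _ => ?_
    rw [qCoeff_succ_succ hq hne, show n + 1 - (m + 1) = n - m by omega]
    ring

/-- Convolution form of the `q`-Chu–Vandermonde sum. -/
theorem sum_antidiagonal_qPoch {q : K} (hne : ∀ k, qPoch q q k ≠ 0) (n : ℕ) (A B : K) :
    ∑ p ∈ antidiagonal n,
        qPoch A q p.1 / qPoch q q p.1 * (qPoch B q p.2 / qPoch q q p.2) * A ^ p.2
      = qPoch (A * B) q n / qPoch q q n := by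
  have hs (k : ℕ) : 1 - q * q ^ k ≠ 0 := by
    intro h; apply hne (k + 1); rw [qPoch_succ, h, mul_zero]
  induction n with
  | zero => simp
  | succ n ih =>
    have key : (1 - q * q ^ n) * ∑ p ∈ antidiagonal (n + 1),
        qPoch A q p.1 / qPoch q q p.1 * (qPoch B q p.2 / qPoch q q p.2) * A ^ p.2
        = (1 - A * B * q ^ n) * (qPoch (A * B) q n / qPoch q q n) := by
      -- `1 - q^{i+j} = (1 - q^i) + q^i (1 - q^j)`; each part lowers one of the two indices.
      have split : (1 - q * q ^ n) * ∑ p ∈ antidiagonal (n + 1),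
          qPoch A q p.1 / qPoch q q p.1 * (qPoch B q p.2 / qPoch q q p.2) * A ^ p.2
          = ∑ p ∈ antidiagonal (n + 1), (1 - q ^ p.1) *
              (qPoch A q p.1 / qPoch q q p.1 * (qPoch B q p.2 / qPoch q q p.2) * A ^ p.2)
            + ∑ p ∈ antidiagonal (n + 1), q ^ p.1 * (1 - q ^ p.2) *
              (qPoch A q p.1 / qPoch q q p.1 * (qPoch B q p.2 / qPoch q q p.2) * A ^ p.2) := by
        rw [mul_sum, ← sum_add_distrib]
        refine sum_congr rfl fun p hp => ?_
        rw [← pow_succ', ← mem_antidiagonal.1 hp, pow_add]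
        ring
      rw [split, Nat.sum_antidiagonal_succ, Nat.sum_antidiagonal_succ' (n := n), ← ih, mul_sum]
      simp only [pow_zero, sub_self, zero_mul, mul_zero, zero_add]
      rw [← sum_add_distrib]
      refine sum_congr rfl fun p hp => ?_
      have h1 := hne p.1
      have h2 := hne p.2
      have h3 := hs p.1
      have h4 := hs p.2
      rw [← mem_antidiagonal.1 hp]
      simp only [qPoch_succ, pow_succ', pow_add]
      field_simp
      ring
    rw [qPoch_succ, qPoch_succ, eq_div_iff (mul_ne_zero (hne n) (hs n))]
    rw [← mul_div_assoc, eq_div_iff (hne n)] at key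
    linear_combination key

theorem qPoch_inv_pow_add {q : K} (hq : q ≠ 0) (m l : ℕ) :
    qPoch (q ^ (m + l))⁻¹ q m * qPoch q q l * q ^ (m * (m + l))
      = (-1) ^ m * q ^ m.choose 2 * qPoch q q (m + l) := by
  induction m with
  | zero => simp
  | succ m ih =>
    have h4 : (q ^ (m + 1 + l))⁻¹ * q = (q ^ (m + l))⁻¹ := by
      rw [show m + 1 + l = m + l + 1 by ring, pow_succ]; field_simp
    have hqn := pow_ne_zero (m + 1 + l) hq
    rw [qPoch_succ', h4, show m + 1 + l = (m + l) + 1 by ring, qPoch_succ q, Nat.choose_succ_succ',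
      Nat.choose_one_right, show (m + 1) * (m + l + 1) = m * (m + l) + m + (m + l + 1) by ring,
      pow_add q (m * (m + l) + m), pow_add q (m * (m + l)), pow_add q m (m.choose 2), pow_succ (-1 : K)]
    rw [show m + 1 + l = (m + l) + 1 by ring] at hqn
    calc _ = (qPoch (q ^ (m + l))⁻¹ q m * qPoch q q l * q ^ (m * (m + l))) *
          (q ^ m * ((1 - (q ^ (m + l + 1))⁻¹) * q ^ (m + l + 1))) := by ring
      _ = _ := by
        rw [ih, sub_mul, inv_mul_cancel₀ hqn]
        ring

end Field

/-! ### The monic `q`-Hahn polynomial and its orthogonality -/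

section Field

variable {K : Type*} [Field K]

/-- The polynomial `x ↦ (c x; q)_m`. -/
noncomputable def qPochPoly (c q : K) (m : ℕ) : K[X] :=
  ∏ j ∈ range m, (1 - C (c * q ^ j) * X)

theorem eval_qPochPoly (c q : K) (m : ℕ) (x : K) :
    (qPochPoly c q m).eval x = qPoch (c * x) q m := by
  simp only [qPochPoly, qPoch, eval_prod, eval_sub, eval_one, eval_mul, eval_C, eval_X]
  exact prod_congr rfl fun j _ => by ring

theorem degree_one_sub_C_mul_X {a : K} (ha : a ≠ 0) : (1 - C a * X : K[X]).degree = 1 := by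
  rw [show (1 - C a * X : K[X]) = C (-a) * X + C 1 by simp; ring]
  exact degree_linear (neg_ne_zero.2 ha)

theorem degree_qPochPoly {c q : K} (hc : c ≠ 0) (hq : q ≠ 0) (m : ℕ) :
    (qPochPoly c q m).degree = m := by
  rw [qPochPoly, degree_prod, sum_congr rfl fun j _ =>
    degree_one_sub_C_mul_X (mul_ne_zero hc (pow_ne_zero j hq))]
  simp

theorem leadingCoeff_qPochPoly {q : K} (hq : q ≠ 0) (m : ℕ) :
    (qPochPoly 1 q m).leadingCoeff = (-1) ^ m * q ^ m.choose 2 := by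
  induction m with
  | zero => simp [qPochPoly]
  | succ m ih =>
    have h : (1 - C (1 * q ^ m) * X : K[X]).leadingCoeff = -q ^ m := by
      rw [show (1 - C (1 * q ^ m) * X : K[X]) = C (-q ^ m) * X + C 1 by simp; ring]
      exact leadingCoeff_linear (neg_ne_zero.2 (pow_ne_zero m hq))
    rw [qPochPoly, prod_range_succ, leadingCoeff_mul, h, ← qPochPoly, ih, Nat.choose_succ_succ',
      Nat.choose_one_right]
    ring

theorem qCoeff_self_mul {q : K} (hq : q ≠ 0) (hne : ∀ k, qPoch q q k ≠ 0) (n : ℕ) :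
    qCoeff q n n * ((-1) ^ n * q ^ n.choose 2) = 1 := by
  have h := qPoch_inv_pow_add hq n 0
  simp only [add_zero, qPoch_zero, mul_one] at h
  have hexp : n.choose 2 + n.choose 2 + n = n * n := by
    have := Nat.choose_two_right n
    have h2 := Nat.div_mul_cancel (Nat.even_mul_pred_self n).two_dvd
    cases n with
    | zero => simp
    | succ n => simp only [Nat.add_sub_cancel] at *; nlinarith
  have hs : ((-1 : K) ^ n) * (-1) ^ n = 1 := by rw [← mul_pow]; simp
  have hqn := pow_ne_zero (n * n) hq
  rw [qCoeff, div_mul_eq_mul_div, div_eq_one_iff_eq (hne n)]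
  refine mul_right_cancel₀ hqn ?_
  calc _ = (qPoch (q ^ n)⁻¹ q n * q ^ (n * n)) * (q ^ n * ((-1) ^ n * q ^ n.choose 2)) := by ring
    _ = ((-1) ^ n * (-1) ^ n) * qPoch q q n * q ^ (n.choose 2 + n.choose 2 + n) := by
      rw [h]; ring
    _ = _ := by rw [hs, hexp, one_mul]

/-- The monic `q`-Hahn polynomial with `α = a q` and `B = a b q ^ (n + 1)`. -/
noncomputable def qHahnPoly (q α B : K) (N n : ℕ) : K[X] :=
  C (qPoch (q ^ N)⁻¹ q n / qPoch B q n) * ∑ m ∈ range (n + 1),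
    C (qCoeff q n m * qPoch B q m * qPoch (α * q ^ m) q (n - m) / qPoch (q ^ N)⁻¹ q m)
      * qPochPoly 1 q m

theorem natDegree_qHahnPoly_le {q : K} (hq : q ≠ 0) (α B : K) (N n : ℕ) :
    (qHahnPoly q α B N n).natDegree ≤ n := by
  refine (natDegree_C_mul_le _ _).trans (natDegree_sum_le_of_forall_le _ _ fun m hm => ?_)
  refine (natDegree_C_mul_le _ _).trans ?_
  rw [natDegree_eq_of_degree_eq_some (degree_qPochPoly one_ne_zero hq m)]
  exact Nat.lt_succ_iff.1 (mem_range.1 hm)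

theorem coeff_qHahnPoly {q : K} (hq : q ≠ 0) (hne : ∀ k, qPoch q q k ≠ 0) (α : K) {B : K}
    {N n : ℕ} (hN : qPoch (q ^ N)⁻¹ q n ≠ 0) (hB : qPoch B q n ≠ 0) :
    (qHahnPoly q α B N n).coeff n = 1 := by
  have hdeg (m : ℕ) : (qPochPoly 1 q m).natDegree = m :=
    natDegree_eq_of_degree_eq_some (degree_qPochPoly one_ne_zero hq m)
  have hc : (qPochPoly 1 q n).coeff n = (-1) ^ n * q ^ n.choose 2 := by
    rw [← leadingCoeff_qPochPoly hq, leadingCoeff, hdeg]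
  rw [qHahnPoly, coeff_C_mul, sum_range_succ, coeff_add, finsetSum_coeff, sum_eq_zero, zero_add,
    coeff_C_mul, hc, Nat.sub_self, qPoch_zero]
  · have := qCoeff_self_mul hq hne n
    generalize qPoch (q ^ N)⁻¹ q n = u at *
    field_simp
    linear_combination this
  · intro m hm
    rw [coeff_C_mul, coeff_eq_zero_of_natDegree_lt, mul_zero]
    rw [hdeg]
    exact mem_range.1 hm

theorem monic_qHahnPoly {q : K} (hq : q ≠ 0) (hne : ∀ k, qPoch q q k ≠ 0) (α : K) {B : K}
    {N n : ℕ} (hN : qPoch (q ^ N)⁻¹ q n ≠ 0) (hB : qPoch B q n ≠ 0) :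
    (qHahnPoly q α B N n).Monic :=
  monic_of_natDegree_le_of_coeff_eq_one n (natDegree_qHahnPoly_le hq ..)
    (coeff_qHahnPoly hq hne α hN hB)

theorem natDegree_qHahnPoly {q : K} (hq : q ≠ 0) (hne : ∀ k, qPoch q q k ≠ 0) (α : K) {B : K}
    {N n : ℕ} (hN : qPoch (q ^ N)⁻¹ q n ≠ 0) (hB : qPoch B q n ≠ 0) :
    (qHahnPoly q α B N n).natDegree = n :=
  natDegree_eq_of_le_of_coeff_ne_zero (natDegree_qHahnPoly_le hq ..)
    (by rw [coeff_qHahnPoly hq hne α hN hB]; exact one_ne_zero)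

theorem eval_qHahnPoly (q α B : K) (N n : ℕ) (x : K) :
    (qHahnPoly q α B N n).eval x = qPoch (q ^ N)⁻¹ q n / qPoch B q n * ∑ m ∈ range (n + 1),
      qCoeff q n m * qPoch B q m * qPoch (α * q ^ m) q (n - m) / qPoch (q ^ N)⁻¹ q m
        * qPoch x q m := by
  simp [qHahnPoly, eval_finsetSum, eval_qPochPoly]

/-- `(1; q)_m = 0` for `m ≥ 1`, so only the constant term of the expansion survives. -/
theorem eval_one_qHahnPoly (q α B : K) (N n : ℕ) :
    (qHahnPoly q α B N n).eval 1 = qPoch (q ^ N)⁻¹ q n / qPoch B q n * qPoch α q n := by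
  rw [eval_qHahnPoly, sum_range_succ', sum_eq_zero]
  · simp [qCoeff_zero_right]
  · intro m _
    rw [qPoch_succ' 1]
    simp

/-- At this node `(x; q)_m` cancels the denominator `(q^{-N}; q)_m`, leaving the Chu–Vandermonde
sum. -/
theorem eval_inv_pow_qHahnPoly {q : K} (hq : q ≠ 0) (hne : ∀ k, qPoch q q k ≠ 0) (α B : K)
    {N n : ℕ} (hN : ∀ m ≤ n, qPoch (q ^ N)⁻¹ q m ≠ 0) :
    (qHahnPoly q α B N n).eval (q ^ N)⁻¹
      = qPoch (q ^ N)⁻¹ q n / qPoch B q n * ∏ j ∈ range n, (B - α * q ^ j) := by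
  rw [eval_qHahnPoly, ← sum_qCoeff_mul_qPoch hq hne]
  congr 1
  refine sum_congr rfl fun m hm => ?_
  rw [div_mul_cancel₀ _ (hN m (Nat.lt_succ_iff.1 (mem_range.1 hm)))]

/-- The moments of the `q`-Hahn weight against products of `q`-Pochhammer symbols. -/
theorem sum_weight_mul_qPoch {q : K} (hq : q ≠ 0) (hne : ∀ k, qPoch q q k ≠ 0) (α β : K)
    {N m : ℕ} (hm : m ≤ N) (k : ℕ) :
    ∑ p ∈ antidiagonal N, qPoch α q p.1 / qPoch q q p.1 * (qPoch β q p.2 / qPoch q q p.2) * α ^ p.2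
        * qPoch (q ^ p.1)⁻¹ q m * qPoch (β * q ^ p.2) q k
      = qPoch α q m * qPoch β q k * qPoch (q ^ N)⁻¹ q m
          * qPoch (α * β * q ^ (m + k)) q (N - m) / qPoch q q N := by
  obtain ⟨M, rfl⟩ := Nat.exists_eq_add_of_le hm
  have key := qPoch_inv_pow_add hq m M
  have hconv := sum_antidiagonal_qPoch hne M (α * q ^ m) (β * q ^ k)
  rw [Nat.sum_antidiagonal_eq_sum_range_succ_mk] at hconv ⊢
  -- Terms with `i < m` vanish because `(q^{-i}; q)_m = 0`. Shifting the rest by `m` gives the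
  -- convolution with parameters `α q^m` and `β q^k`.
  rw [show (m + M).succ = m + M.succ by omega, sum_range_add, sum_eq_zero, zero_add]
  swap
  · intro i hi
    rw [qPoch_inv_pow_eq_zero hq (mem_range.1 hi)]
    simp
  rw [show m + M - m = M by omega]
  have e : qPoch α q m * qPoch β q k * qPoch (q ^ (m + M))⁻¹ q m
          * qPoch (α * β * q ^ (m + k)) q M / qPoch q q (m + M)
      = qPoch α q m * qPoch β q k * ((-1) ^ m * q ^ m.choose 2) / q ^ (m * (m + M))
        * (qPoch (α * q ^ m * (β * q ^ k)) q M / qPoch q q M) := by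
    have h1 := hne M
    have h2 := hne (m + M)
    have h3 := pow_ne_zero (m * (m + M)) hq
    rw [show α * q ^ m * (β * q ^ k) = α * β * q ^ (m + k) by ring]
    generalize qPoch (q ^ (m + M))⁻¹ q m = u at *
    rw [div_mul_div_comm, div_eq_div_iff h2 (mul_ne_zero h3 h1)]
    linear_combination qPoch α q m * qPoch β q k * qPoch (α * β * q ^ (m + k)) q M * key
  rw [e, ← hconv, mul_sum]
  refine sum_congr rfl fun l hl => ?_
  obtain ⟨j, rfl⟩ := Nat.exists_eq_add_of_le (Nat.lt_succ_iff.1 (mem_range.1 hl))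
  have keyl := qPoch_inv_pow_add hq m l
  rw [show m + (l + j) - (m + l) = j by omega, show l + j - l = j by omega]
  have h1 := hne l
  have h2 := hne (m + l)
  have h3 := hne j
  have h4 := pow_ne_zero (m * (m + (l + j))) hq
  have h5 := pow_ne_zero (m * (m + l)) hq
  have hk : qPoch β q k * qPoch (β * q ^ k) q j = qPoch β q j * qPoch (β * q ^ j) q k := by
    rw [← qPoch_add, ← qPoch_add, add_comm]
  have hl' : qPoch (q ^ (m + l))⁻¹ q m
      = (-1) ^ m * q ^ m.choose 2 * qPoch q q (m + l) / (qPoch q q l * q ^ (m * (m + l))) := by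
    rw [eq_div_iff (mul_ne_zero h1 h5), ← keyl]; ring
  rw [hl', qPoch_add α]
  calc _ = (qPoch β q j * qPoch (β * q ^ j) q k) * (qPoch α q m * qPoch (α * q ^ m) q l *
        ((-1) ^ m * q ^ m.choose 2) * α ^ j / (qPoch q q l * qPoch q q j * q ^ (m * (m + l)))) := by
        field_simp
    _ = _ := by
      rw [← hk, show m * (m + (l + j)) = m * (m + l) + m * j by ring, pow_add q (m * (m + l)),
        mul_pow α, ← pow_mul]
      field_simp

/-- Orthogonality of the `q`-Hahn polynomial to the test functions `(β q ^ (N - x); q)_k`. -/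
theorem sum_weight_mul_qHahnPoly_qPoch {q : K} (hq : q ≠ 0) (hne : ∀ k, qPoch q q k ≠ 0)
    (α β B : K) {N n k : ℕ} (hn : n ≤ N) (hN : ∀ m ≤ n, qPoch (q ^ N)⁻¹ q m ≠ 0) (hk : k < n)
    (hB : B = α * β * q ^ (n - 1)) :
    ∑ p ∈ antidiagonal N, qPoch α q p.1 / qPoch q q p.1 * (qPoch β q p.2 / qPoch q q p.2) * α ^ p.2
        * (qHahnPoly q α B N n).eval (q ^ p.1)⁻¹ * qPoch (β * q ^ p.2) q k = 0 := by
  have swap : ∑ p ∈ antidiagonal N,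
      qPoch α q p.1 / qPoch q q p.1 * (qPoch β q p.2 / qPoch q q p.2) * α ^ p.2
        * (qHahnPoly q α B N n).eval (q ^ p.1)⁻¹ * qPoch (β * q ^ p.2) q k
      = qPoch (q ^ N)⁻¹ q n / qPoch B q n * ∑ m ∈ range (n + 1),
        qCoeff q n m * qPoch B q m * qPoch (α * q ^ m) q (n - m) / qPoch (q ^ N)⁻¹ q m
          * ∑ p ∈ antidiagonal N,
            qPoch α q p.1 / qPoch q q p.1 * (qPoch β q p.2 / qPoch q q p.2) * α ^ p.2
              * qPoch (q ^ p.1)⁻¹ q m * qPoch (β * q ^ p.2) q k := by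
    simp only [eval_qHahnPoly, mul_sum, sum_mul]
    rw [sum_comm]
    exact sum_congr rfl fun m _ => sum_congr rfl fun p _ => by ring
  have inner : ∀ m ∈ range (n + 1),
      qCoeff q n m * qPoch B q m * qPoch (α * q ^ m) q (n - m) / qPoch (q ^ N)⁻¹ q m
          * ∑ p ∈ antidiagonal N,
            qPoch α q p.1 / qPoch q q p.1 * (qPoch β q p.2 / qPoch q q p.2) * α ^ p.2
              * qPoch (q ^ p.1)⁻¹ q m * qPoch (β * q ^ p.2) q k
      = qPoch α q n * qPoch β q k * qPoch (α * β * q ^ (n + k)) q (N - n) / qPoch q q N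
        * (qCoeff q n m * qPoch B q m * qPoch (α * β * q ^ k * q ^ m) q (n - m)) := by
    intro m hm
    have hmn := Nat.lt_succ_iff.1 (mem_range.1 hm)
    have h1 := hN m hmn
    have h2 := hne N
    rw [sum_weight_mul_qPoch hq hne α β (hmn.trans hn)]
    obtain ⟨i, rfl⟩ := Nat.exists_eq_add_of_le hmn
    obtain ⟨j, rfl⟩ := Nat.exists_eq_add_of_le hn
    rw [show m + i + j - m = i + j by omega, show m + i - m = i by omega,
      show m + i + j - (m + i) = j by omega, qPoch_add _ _ i j, qPoch_add α q m i,
      show α * β * q ^ (m + k) * q ^ i = α * β * q ^ (m + i + k) by ring,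
      show α * β * q ^ k * q ^ m = α * β * q ^ (m + k) by ring]
    generalize qPoch (q ^ (m + i + j))⁻¹ q m = u at *
    field_simp
  -- The sum is a multiple of `∏_{j<n} (B - αβ q^{k+j})`, whose factor `j = n - 1 - k` is zero.
  rw [swap, sum_congr rfl inner, ← mul_sum, sum_qCoeff_mul_qPoch hq hne,
    prod_eq_zero (i := n - 1 - k) (mem_range.2 (by omega))]
  · simp
  · rw [hB, mul_assoc _ (q ^ k), ← pow_add, show k + (n - 1 - k) = n - 1 by omega, sub_self]

/-- Orthogonality of the `q`-Hahn polynomial to all polynomials of smaller degree. -/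
theorem sum_weight_mul_qHahnPoly_eval {q : K} (hq : q ≠ 0) (hne : ∀ k, qPoch q q k ≠ 0)
    (α : K) {β : K} (B : K) {N n : ℕ} (hβ : β ≠ 0) (hn : n ≤ N)
    (hN : ∀ m ≤ n, qPoch (q ^ N)⁻¹ q m ≠ 0) (hB : B = α * β * q ^ (n - 1)) {r : K[X]}
    (hr : r.degree < n) :
    ∑ p ∈ antidiagonal N, qPoch α q p.1 / qPoch q q p.1 * (qPoch β q p.2 / qPoch q q p.2) * α ^ p.2
        * (qHahnPoly q α B N n).eval (q ^ p.1)⁻¹ * r.eval (q ^ p.1)⁻¹ = 0 := by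
  have hc : β * q ^ N ≠ 0 := mul_ne_zero hβ (pow_ne_zero N hq)
  -- At the node `q^{-i}` the factor `β q^N x` is `β q^{N-i}`, so these are the test functions
  -- above; having one in each degree, they span.
  let S : Polynomial.Sequence K := ⟨qPochPoly (β * q ^ N) q, degree_qPochPoly hc hq⟩
  have hspan := S.span_degreeLT (m := n) fun i _ =>
    isUnit_iff_ne_zero.2 (leadingCoeff_ne_zero.2 (S.ne_zero i))
  have hr' := mem_degreeLT.2 hr
  rw [← hspan] at hr'
  clear hr
  induction hr' using Submodule.span_induction with
  | mem r h =>
    obtain ⟨k, hk, rfl⟩ := h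
    rw [← sum_weight_mul_qHahnPoly_qPoch hq hne α β B hn hN hk hB]
    refine sum_congr rfl fun p hp => ?_
    congr 1
    change (qPochPoly (β * q ^ N) q k).eval _ = _
    have h1 := pow_ne_zero p.1 hq
    rw [eval_qPochPoly, ← mem_antidiagonal.1 hp, pow_add]
    congr 1
    field_simp
  | zero => simp
  | add x y _ _ hx hy => simp only [eval_add, mul_add, sum_add_distrib, hx, hy, add_zero]
  | smul a x _ hx =>
    simp only [eval_smul, smul_eq_mul, mul_left_comm _ a, ← mul_sum, hx, mul_zero]

end Field

/-! ### Real zeros from sign changes and orthogonality -/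

namespace Polynomial

/-- A real polynomial has constant sign on an interval after multiplication by linear factors at
suitable roots in that interval. -/
theorem exists_finset_roots_mul_prod_const_sign {P : ℝ[X]} (hP : P ≠ 0) (I : Set ℝ)
    (hI : I.OrdConnected) :
    ∃ S : Finset ℝ, (∀ s ∈ S, s ∈ I ∧ P.IsRoot s) ∧
      ((∀ x ∈ I, 0 ≤ (P * ∏ s ∈ S, (X - C s)).eval x) ∨
        ∀ x ∈ I, (P * ∏ s ∈ S, (X - C s)).eval x ≤ 0) := by
  induction h : P.natDegree using Nat.strong_induction_on generalizing P with
  | _ d ih =>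
    by_cases hroot : ∃ s ∈ I, P.IsRoot s
    · obtain ⟨s, hs, hr⟩ := hroot
      obtain ⟨Q, rfl⟩ := dvd_iff_isRoot.2 hr
      have hQ : Q ≠ 0 := right_ne_zero_of_mul hP
      have hd : Q.natDegree < d := by
        rw [← h, natDegree_mul (X_sub_C_ne_zero s) hQ, natDegree_X_sub_C]
        omega
      obtain ⟨S, hS, hsign⟩ := ih _ hd hQ rfl
      have hroots : ∀ t ∈ S, t ∈ I ∧ ((X - C s) * Q).IsRoot t := fun t ht =>
        ⟨(hS t ht).1, root_mul_left_of_isRoot _ (hS t ht).2⟩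
      -- Toggling `s` in `S` tracks the parity of its multiplicity: the product is unchanged or
      -- gains the square `(x - s)^2`.
      by_cases hmem : s ∈ S
      · refine ⟨S.erase s, fun t ht => hroots t (mem_of_mem_erase ht), ?_⟩
        rwa [mul_comm (X - C s) Q, mul_assoc, mul_prod_erase S (fun t => X - C t) hmem]
      · refine ⟨insert s S, ?_, ?_⟩
        · intro t ht
          rcases mem_insert.1 ht with rfl | ht
          · exact ⟨hs, hr⟩
          · exact hroots t ht
        · have e (x : ℝ) : ((X - C s) * Q * ∏ t ∈ insert s S, (X - C t)).eval x
              = (x - s) ^ 2 * (Q * ∏ t ∈ S, (X - C t)).eval x := by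
            rw [prod_insert hmem]
            simp only [eval_mul, eval_sub, eval_X, eval_C]
            ring
          simp only [e]
          exact hsign.imp (fun H x hx => mul_nonneg (sq_nonneg _) (H x hx))
            fun H x hx => mul_nonpos_of_nonneg_of_nonpos (sq_nonneg _) (H x hx)
    · refine ⟨∅, by simp, ?_⟩
      by_contra! hcon
      simp only [prod_empty, mul_one] at hcon
      obtain ⟨⟨x, hx, hx'⟩, y, hy, hy'⟩ := hcon
      obtain ⟨z, hz, hz'⟩ := hI.isPreconnected.intermediate_value hx hy
        P.continuousOn ⟨hx'.le, hy'.le⟩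
      exact hroot ⟨z, hz, hz'⟩

theorem Monic.exists_isRoot_gt {P : ℝ[X]} (hP : P.Monic) {c : ℝ} (hc : P.eval c < 0) :
    ∃ t, c < t ∧ P.IsRoot t := by
  have hdeg : 0 < P.degree := by
    rw [← natDegree_pos_iff_degree_pos, Nat.pos_iff_ne_zero]
    intro h
    rw [hP.natDegree_eq_zero.1 h, eval_one] at hc
    linarith
  have hlim := tendsto_atTop_of_leadingCoeff_nonneg P hdeg (by rw [hP.leadingCoeff]; norm_num)
  obtain ⟨d, hd, hcd⟩ := ((hlim.eventually_ge_atTop 0).and (Filter.eventually_gt_atTop c)).exists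
  obtain ⟨t, ht, ht'⟩ := intermediate_value_Ioc hcd.le P.continuousOn ⟨hc, hd⟩
  exact ⟨t, ht.1, ht'⟩

theorem Monic.exists_isRoot_lt {P : ℝ[X]} (hP : P.Monic) {c : ℝ}
    (hc : (-1) ^ P.natDegree * P.eval c < 0) : ∃ t < c, P.IsRoot t := by
  have hs : ((-1 : ℝ) ^ P.natDegree) * (-1) ^ P.natDegree = 1 := by rw [← mul_pow]; simp
  have hR : (C ((-1) ^ P.natDegree) * P.comp (-X)).Monic := by
    rw [Monic, leadingCoeff_mul, leadingCoeff_C, leadingCoeff_comp (by simp), leadingCoeff_neg,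
      leadingCoeff_X, hP.leadingCoeff, one_mul, hs]
  obtain ⟨t, ht, hroot⟩ := hR.exists_isRoot_gt (c := -c) (by simpa [eval_comp] using hc)
  refine ⟨-t, by linarith, ?_⟩
  simpa [IsRoot, eval_comp] using hroot

end Polynomial

/-- A monic polynomial of degree `n` orthogonal, with respect to a finite weight which is positive
strictly between `a` and `b`, to `(x - a) (x - b) r` for all `r` of degree less than `n - 2`, with
the signs at `a`, `b` forcing roots outside `[a, b]`, has `n` distinct real roots. -/
theorem Polynomial.Monic.exists_finset_roots_of_orthogonal {ι : Type*} {P : ℝ[X]} (hP : P.Monic)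
    {a b : ℝ} (hab : a < b)
    (ha : (-1) ^ P.natDegree * P.eval a < 0) (hb : P.eval b < 0) (s : Finset ι) (y w : ι → ℝ)
    (hinj : Set.InjOn y s) (hy : ∀ i ∈ s, y i ∈ Set.Ioo a b) (hw : ∀ i ∈ s, 0 < w i)
    (hcard : P.natDegree < s.card + 2)
    (horth : ∀ r : ℝ[X], r.degree < P.natDegree → r.IsRoot a → r.IsRoot b →
      ∑ i ∈ s, w i * P.eval (y i) * r.eval (y i) = 0) :
    ∃ T : Finset ℝ, T.card = P.natDegree ∧ (∀ t ∈ T, P.IsRoot t) ∧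
      (∃ t ∈ T, t < a) ∧ ∃ t ∈ T, b < t := by
  classical
  obtain ⟨l, hl, hlroot⟩ := hP.exists_isRoot_lt ha
  obtain ⟨u, hu, huroot⟩ := hP.exists_isRoot_gt hb
  have extend (S : Finset ℝ) (hS : ∀ t ∈ S, t ∈ Set.Ioo a b ∧ P.IsRoot t) :
      (insert l (insert u S)).card = S.card + 2 ∧ ∀ t ∈ insert l (insert u S), P.IsRoot t := by
    have huS : u ∉ S := fun h => by linarith [(hS u h).1.2]
    have hlS : l ∉ insert u S := fun h => by
      rcases mem_insert.1 h with h | h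
      · linarith
      · linarith [(hS l h).1.1]
    refine ⟨by rw [card_insert_of_notMem hlS, card_insert_of_notMem huS], fun t ht => ?_⟩
    rcases mem_insert.1 ht with rfl | ht
    · exact hlroot
    rcases mem_insert.1 ht with rfl | ht
    exacts [huroot, (hS t ht).2]
  have card_le (T : Finset ℝ) (hT : ∀ t ∈ T, P.IsRoot t) : T.card ≤ P.natDegree := by
    refine (card_le_card fun t ht => ?_).trans (P.roots.toFinset_card_le.trans (card_roots' P))
    rw [Multiset.mem_toFinset, mem_roots hP.ne_zero]
    exact hT t ht
  obtain ⟨S, hS, hsign⟩ := exists_finset_roots_mul_prod_const_sign hP.ne_zero (Set.Ioo a b)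
    Set.ordConnected_Ioo
  obtain ⟨hc, hroots⟩ := extend S hS
  refine ⟨_, le_antisymm (card_le _ hroots) ?_, hroots, ⟨l, by simp, hl⟩, u, by simp, hu⟩
  rw [hc]
  by_contra! hlt
  -- With too few inner roots this test polynomial has degree below that of `P`, and every summand
  -- has the same sign.
  have hsum := horth ((X - C a) * (X - C b) * ∏ t ∈ S, (X - C t)) (by
    rw [Polynomial.degree_mul, Polynomial.degree_mul, degree_X_sub_C, degree_X_sub_C, degree_prod]
    simp only [degree_X_sub_C, sum_const, nsmul_eq_mul, mul_one]
    exact_mod_cast (by omega : 1 + 1 + S.card < P.natDegree)) (by simp) (by simp)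
  have hterm (i : ι) : w i * P.eval (y i) * ((X - C a) * (X - C b) * ∏ t ∈ S, (X - C t)).eval (y i)
      = -(w i * ((y i - a) * (b - y i))) * (P * ∏ t ∈ S, (X - C t)).eval (y i) := by
    simp only [eval_mul, eval_sub, eval_X, eval_C]
    ring
  simp only [hterm] at hsum
  have hneg : ∀ i ∈ s, -(w i * ((y i - a) * (b - y i))) < 0 := fun i hi =>
    neg_lt_zero.2 (mul_pos (hw i hi)
      (mul_pos (sub_pos.2 (hy i hi).1) (sub_pos.2 (hy i hi).2)))
  have hzero : ∀ i ∈ s, P.IsRoot (y i) := by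
    intro i hi
    have h0 : (P * ∏ t ∈ S, (X - C t)).eval (y i) = 0 := by
      refine (mul_eq_zero.1 ?_).resolve_left (hneg i hi).ne
      rcases hsign with h | h
      · exact (sum_eq_zero_iff_of_nonpos fun j hj =>
          mul_nonpos_of_nonpos_of_nonneg (hneg j hj).le (h _ (hy j hj))).1 hsum i hi
      · exact (sum_eq_zero_iff_of_nonneg fun j hj =>
          mul_nonneg_of_nonpos_of_nonpos (hneg j hj).le (h _ (hy j hj))).1 hsum i hi
    rw [eval_mul, eval_prod] at h0
    rcases mul_eq_zero.1 h0 with h0 | h0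
    · exact h0
    · obtain ⟨t, ht, h0⟩ := prod_eq_zero_iff.1 h0
      rw [eval_sub, eval_X, eval_C, sub_eq_zero] at h0
      rw [h0]
      exact (hS t ht).2
  -- All terms vanish, so every node is a root; with the two outer roots these exceed the degree.
  obtain ⟨hc', hroots'⟩ := extend (s.image y) fun t ht => by
    obtain ⟨i, hi, rfl⟩ := mem_image.1 ht
    exact ⟨hy i hi, hzero i hi⟩
  have := card_le _ hroots'
  rw [hc', card_image_of_injOn hinj] at this
  omega

/-! ### Base change along ring homomorphisms -/

theorem map_qPoch {R S : Type*} [CommRing R] [CommRing S] (f : R →+* S) (a q : R) (m : ℕ) :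
    f (qPoch a q m) = qPoch (f a) (f q) m := by
  simp [qPoch, map_prod]

theorem map_qHahnPoly {K L : Type*} [Field K] [Field L] (f : K →+* L) (q α B : K) (N n : ℕ) :
    (qHahnPoly q α B N n).map f = qHahnPoly (f q) (f α) (f B) N n := by
  simp [qHahnPoly, qCoeff, qPochPoly, Polynomial.map_sum, Polynomial.map_prod, map_qPoch]

/-! ### Signs of the weight and of the values at the end nodes -/

section Real

variable {q : ℝ}

theorem qPoch_pos (hq0 : 0 < q) (hq1 : q < 1) {a : ℝ} (ha0 : 0 ≤ a) (ha : a < 1) (m : ℕ) :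
    0 < qPoch a q m :=
  prod_pos fun _ _ => sub_pos.2 <|
    (mul_le_of_le_one_right ha0 (pow_le_one₀ hq0.le hq1.le)).trans_lt ha

/-- Only the first factor `1 - a` is negative. Hence the weight is positive at inner nodes, where
both symbols have positive length, and negative at an end node, where one is empty. -/
theorem qPoch_neg (hq0 : 0 < q) (hq1 : q < 1) {a : ℝ} (ha : 1 < a) (haq : a * q < 1) {m : ℕ}
    (hm : m ≠ 0) : qPoch a q m < 0 := by
  obtain ⟨k, rfl⟩ := Nat.exists_eq_succ_of_ne_zero hm
  rw [qPoch_succ']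
  exact mul_neg_of_neg_of_pos (by linarith) (qPoch_pos hq0 hq1 (by positivity) haq k)

theorem neg_one_pow_mul_qPoch_inv_pow_pos (hq0 : 0 < q) (hq1 : q < 1) {N m : ℕ} (hm : m ≤ N) :
    0 < (-1) ^ m * qPoch (q ^ N)⁻¹ q m := by
  induction m with
  | zero => simp
  | succ m ih =>
    have h : 1 < (q ^ N)⁻¹ * q ^ m := by
      rw [inv_mul_eq_div, one_lt_div (by positivity)]
      exact pow_lt_pow_right_of_lt_one₀ hq0 hq1 hm
    rw [qPoch_succ, show (-1) ^ (m + 1) * (qPoch (q ^ N)⁻¹ q m * (1 - (q ^ N)⁻¹ * q ^ m))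
      = (-1) ^ m * qPoch (q ^ N)⁻¹ q m * ((q ^ N)⁻¹ * q ^ m - 1) by ring]
    exact mul_pos (ih (by omega)) (by linarith)

/-- The factors with `j < n` are negative because `βq < 1`; the last is positive because `β > 1`.
This one exceptional factor makes the value at `q^{-N}` negative. -/
theorem prod_sub_mul_pow_sign (hq0 : 0 < q) (hq1 : q < 1) {α β : ℝ} (hα : 0 < α) (hβ : 1 < β)
    (hβq : β * q < 1) (n : ℕ) :
    0 < (-1) ^ n * ∏ j ∈ range (n + 1), (α * β * q ^ n - α * q ^ j) := by
  have h : (-1) ^ n * ∏ j ∈ range n, (α * β * q ^ n - α * q ^ j)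
      = ∏ j ∈ range n, (α * q ^ j - α * β * q ^ n) := by
    have := prod_const (s := range n) (-1 : ℝ)
    rw [card_range] at this
    rw [← this, ← prod_mul_distrib]
    exact prod_congr rfl fun j _ => by ring
  rw [prod_range_succ, ← mul_assoc, h]
  refine mul_pos (prod_pos fun j hj => ?_) ?_
  · obtain ⟨k, rfl⟩ := Nat.exists_eq_add_of_lt (mem_range.1 hj)
    have h1 : β * q * q ^ k < 1 :=
      (mul_le_of_le_one_right (by positivity) (pow_le_one₀ hq0.le hq1.le)).trans_lt hβq
    rw [show α * q ^ j - α * β * q ^ (j + k + 1) = α * q ^ j * (1 - β * q * q ^ k) by ring]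
    have : 0 < 1 - β * q * q ^ k := by linarith
    positivity
  · rw [show α * β * q ^ n - α * q ^ n = α * q ^ n * (β - 1) by ring]
    have : 0 < β - 1 := by linarith
    positivity

theorem exists_finset_roots_qHahnPoly (hq0 : 0 < q) (hq1 : q < 1) {α β B : ℝ} (hα : 1 < α)
    (hαq : α * q < 1) (hβ : 1 < β) (hβq : β * q < 1) {N n : ℕ} (hn : n ≤ N) (hn2 : 2 ≤ n)
    (hB : B = α * β * q ^ (n - 1)) (hB1 : B < 1) :
    ∃ T : Finset ℝ, T.card = n ∧ (∀ t ∈ T, (qHahnPoly q α B N n).IsRoot t) ∧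
      (∃ t ∈ T, t < 1) ∧ ∃ t ∈ T, (q ^ N)⁻¹ < t := by
  have hne (k : ℕ) : qPoch q q k ≠ 0 := (qPoch_pos hq0 hq1 hq0.le hq1 k).ne'
  have hNs (m : ℕ) (hm : m ≤ n) : 0 < (-1) ^ m * qPoch (q ^ N)⁻¹ q m :=
    neg_one_pow_mul_qPoch_inv_pow_pos hq0 hq1 (hm.trans hn)
  have hN (m : ℕ) (hm : m ≤ n) : qPoch (q ^ N)⁻¹ q m ≠ 0 :=
    right_ne_zero_of_mul (hNs m hm).ne'
  have hB0 : 0 ≤ B := by rw [hB]; positivity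
  have hBpos := qPoch_pos hq0 hq1 hB0 hB1 n
  have hdeg := natDegree_qHahnPoly hq0.ne' hne α (hN n le_rfl) hBpos.ne'
  have hmonic := monic_qHahnPoly hq0.ne' hne α (hN n le_rfl) hBpos.ne'
  have hpow {i j : ℕ} (hij : i < j) : (q ^ i)⁻¹ < (q ^ j)⁻¹ :=
    inv_strictAnti₀ (by positivity) (pow_lt_pow_right_of_lt_one₀ hq0 hq1 hij)
  have hM : 1 < (q ^ N)⁻¹ := by simpa using hpow (show 0 < N by omega)
  have key := hmonic.exists_finset_roots_of_orthogonal hM ?_ ?_ (Ioo 0 N) (fun i => (q ^ i)⁻¹)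
    (fun i => qPoch α q i / qPoch q q i * (qPoch β q (N - i) / qPoch q q (N - i)) * α ^ (N - i))
    (fun i _ j _ hij => by
      rcases lt_trichotomy i j with h | h | h
      exacts [absurd hij (hpow h).ne, h, absurd hij (hpow h).ne']) ?_ ?_ ?_ ?_
  · rwa [hdeg] at key
  · rw [hdeg, eval_one_qHahnPoly, ← mul_assoc, mul_div_assoc']
    exact mul_neg_of_pos_of_neg (div_pos (hNs n le_rfl) hBpos)
      (qPoch_neg hq0 hq1 hα hαq (by omega))
  · rw [eval_inv_pow_qHahnPoly hq0.ne' hne α B hN, hB]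
    rw [hB] at hBpos
    obtain ⟨k, rfl⟩ := Nat.exists_eq_succ_of_ne_zero (show n ≠ 0 by omega)
    have h1 := prod_sub_mul_pow_sign hq0 hq1 (zero_lt_one.trans hα) hβ hβq k
    have h2 := hNs (k + 1) le_rfl
    simp only [Nat.succ_eq_add_one, Nat.add_sub_cancel] at hBpos ⊢
    have hs : ((-1 : ℝ) ^ k) * (-1) ^ k = 1 := by rw [← mul_pow]; simp
    rw [div_mul_eq_mul_div]
    refine div_neg_of_neg_of_pos ?_ hBpos
    have h3 := mul_pos h2 h1
    rw [pow_succ] at h3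
    linear_combination h3 - qPoch (q ^ N)⁻¹ q (k + 1) *
      (∏ j ∈ range (k + 1), (α * β * q ^ k - α * q ^ j)) * hs
  · intro i hi
    obtain ⟨h0, h1⟩ := mem_Ioo.1 hi
    exact ⟨by simpa using hpow h0, hpow h1⟩
  · intro i hi
    obtain ⟨h0, h1⟩ := mem_Ioo.1 hi
    have hpos (k : ℕ) := qPoch_pos hq0 hq1 hq0.le hq1 k
    have e1 := qPoch_neg hq0 hq1 hα hαq h0.ne'
    have e2 := qPoch_neg hq0 hq1 hβ hβq (Nat.sub_ne_zero_of_lt h1)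
    exact mul_pos (mul_pos_of_neg_of_neg (div_neg_of_neg_of_pos e1 (hpos _))
      (div_neg_of_neg_of_pos e2 (hpos _))) (by positivity)
  · rw [hdeg, Nat.card_Ioo]
    omega
  · intro r hr h1 hNr
    rw [hdeg] at hr
    rw [← sum_weight_mul_qHahnPoly_eval hq0.ne' hne α B (by positivity : β ≠ 0) hn hN hB hr,
      Nat.sum_antidiagonal_eq_sum_range_succ_mk]
    -- The end nodes can be dropped since `r` vanishes there.
    refine sum_subset (fun i hi => mem_range.2 (by have := (mem_Ioo.1 hi).2; omega)) ?_
    intro i hi hi'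
    have h : i = 0 ∨ i = N := by
      have := mem_range.1 hi
      rw [mem_Ioo] at hi'
      omega
    have : r.eval (q ^ i)⁻¹ = 0 := by
      rcases h with rfl | rfl
      · simpa using h1
      · exact hNr
    rw [this, mul_zero]

end Real

/-! ### Passage to the complex hypergeometric definition -/

/-- The series stops at `n`, and nonvanishing of `(αq; q)_m` lets the prefactor absorb this
denominator. -/
theorem qHahn_eq_eval {q α β : ℂ} (hq : q ≠ 0) {N n : ℕ} (hα : ∀ m, qPoch (α * q) q m ≠ 0) (x : ℂ) :
    qHahn q α β N n x = (qHahnPoly q (α * q) (α * β * q ^ (n + 1)) N n).eval x := by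
  have hP (a : ℂ) (m : ℕ) : qPochhammer a q m = qPoch a q m := rfl
  rw [qHahn, basicHypergeometric, eval_qHahnPoly, tsum_eq_sum (s := range (n + 1))]
  · have hB : α * β * q * q ^ n = α * β * q ^ (n + 1) := by ring
    rw [mul_sum, mul_sum]
    refine sum_congr rfl fun m hm => ?_
    obtain ⟨i, rfl⟩ := Nat.exists_eq_add_of_le (Nat.lt_succ_iff.1 (mem_range.1 hm))
    have h1 := hα m
    simp only [qPochhammerList, hP, List.map_cons, List.map_nil, List.prod_cons, List.prod_nil,
      List.length_cons, List.length_nil, zpow_neg, zpow_natCast, hB, qCoeff,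
      show m + i - m = i by omega, qPoch_add (α * q) q m i]
    norm_num
    field_simp
  · intro m hm
    have h : qPoch (q ^ n)⁻¹ q m = 0 :=
      qPoch_inv_pow_eq_zero hq (by simpa [Nat.lt_succ_iff] using hm)
    simp [qPochhammerList, hP, h]

theorem Polynomial.Monic.eq_prod_X_sub_C_of_card_eq {R : Type*} [CommRing R] [IsDomain R]
    {P : R[X]} (hP : P.Monic) {T : Finset R} (hT : ∀ t ∈ T, P.IsRoot t)
    (hcard : T.card = P.natDegree) : P = ∏ t ∈ T, (X - C t) := by
  have hle : T.val ≤ P.roots := (Multiset.le_iff_subset T.nodup).2 fun t ht =>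
    (mem_roots hP.ne_zero).2 (hT t ht)
  have hdvd := (Multiset.prod_X_sub_C_dvd_iff_le_roots hP.ne_zero T.val).2 hle
  refine eq_of_monic_of_dvd_of_natDegree_le (monic_prod_of_monic _ _ fun t _ => monic_X_sub_C t)
    hP hdvd ?_
  rw [natDegree_prod_of_monic _ _ fun t _ => monic_X_sub_C t]
  simp [hcard]

theorem theorem2p8 (q α β : ℝ) (hq0 : 0 < q) (hq1 : q < 1)
    (hα : 1 < α) (hαq : α * q < 1) (hβ : 1 < β) (hβq : β * q < 1)
    (N n : ℕ) (hn : n ≤ N) (hn2 : n = 2 → α * β * q < 1) :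
    ∃ z : Fin n → ℝ, StrictMono z ∧
      (∀ x : ℂ, qHahn (q : ℂ) ((α / q : ℝ) : ℂ) ((β / q : ℝ) : ℂ) N n x
        = ∏ j : Fin n, (x - (z j : ℂ))) ∧
      (∀ x : ℂ, qHahn (q : ℂ) ((α / q : ℝ) : ℂ) ((β / q : ℝ) : ℂ) N n x = 0
        ↔ ∃ j : Fin n, x = (z j : ℂ)) ∧
      ∀ h : 2 ≤ n, z ⟨0, by omega⟩ < 1 ∧ q ^ (-(N : ℤ)) < z ⟨n - 1, by omega⟩ := by
  set B : ℝ := α / q * (β / q) * q ^ (n + 1) with hBdef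
  have hne (k : ℕ) : qPoch q q k ≠ 0 := (qPoch_pos hq0 hq1 hq0.le hq1 k).ne'
  have hα0 (k : ℕ) : qPoch α q k ≠ 0 := by
    rcases eq_or_ne k 0 with rfl | hk
    · simp
    · exact (qPoch_neg hq0 hq1 hα hαq hk).ne
  -- At `n = 0` the truncated exponent `n - 1` would be wrong.
  have hB (h : n ≠ 0) : B = α * β * q ^ (n - 1) := by
    obtain ⟨k, rfl⟩ := Nat.exists_eq_succ_of_ne_zero h
    rw [hBdef, Nat.succ_eq_add_one, Nat.add_sub_cancel, pow_succ, pow_succ]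
    field_simp
  have hB1 (h : 2 ≤ n) : B < 1 := by
    rw [hB (by omega)]
    rcases h.eq_or_lt with rfl | h
    · simpa using hn2 rfl
    -- For `n ≥ 3` two powers of `q` are available, one for each of `α` and `β`.
    · calc α * β * q ^ (n - 1) ≤ α * β * q ^ 2 :=
          mul_le_mul_of_nonneg_left (pow_le_pow_of_le_one hq0.le hq1.le (by omega)) (by positivity)
        _ = (α * q) * (β * q) := by ring
        _ < 1 := mul_lt_one_of_nonneg_of_lt_one_left (by positivity) hαq hβq.le
  have hBne : qPoch B q n ≠ 0 := by
    rcases Nat.lt_or_ge n 2 with h | h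
    · interval_cases n
      · simp
      -- For `n = 1` the symbol is `1 - αβ`, nonzero because `αβ > 1`.
      · rw [hB one_ne_zero]
        simp only [qPoch, range_one, prod_singleton, pow_zero, mul_one, Nat.sub_self]
        nlinarith
    · exact (qPoch_pos hq0 hq1 (by positivity) (hB1 h) n).ne'
  have hN : qPoch (q ^ N)⁻¹ q n ≠ 0 :=
    right_ne_zero_of_mul (neg_one_pow_mul_qPoch_inv_pow_pos hq0 hq1 hn).ne'
  have hdeg := natDegree_qHahnPoly hq0.ne' hne α hN hBne
  have hmonic := monic_qHahnPoly hq0.ne' hne α hN hBne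
  obtain ⟨T, hcard, hroots, hext⟩ : ∃ T : Finset ℝ, T.card = n ∧
      (∀ t ∈ T, (qHahnPoly q α B N n).IsRoot t) ∧
      (2 ≤ n → (∃ t ∈ T, t < 1) ∧ ∃ t ∈ T, (q ^ N)⁻¹ < t) := by
    rcases Nat.lt_or_ge n 2 with h | h
    · rcases Nat.eq_zero_or_pos n with h0 | h0
      · exact ⟨∅, by simp [h0], by simp, by omega⟩
      · have h1 : n = 1 := by omega
        obtain ⟨t, ht⟩ := exists_root_of_degree_eq_one
          ((degree_eq_iff_natDegree_eq hmonic.ne_zero).2 (hdeg.trans h1))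
        exact ⟨{t}, by simp [h1], by simpa using ht, by omega⟩
    · obtain ⟨T, h1, h2, h3⟩ := exists_finset_roots_qHahnPoly hq0 hq1 hα hαq hβ hβq hn h
        (hB (by omega)) (hB1 h)
      exact ⟨T, h1, h2, fun _ => h3⟩
  have hfac := hmonic.eq_prod_X_sub_C_of_card_eq hroots (hcard.trans hdeg.symm)
  have hqHahn (x : ℂ) : qHahn (q : ℂ) ((α / q : ℝ) : ℂ) ((β / q : ℝ) : ℂ) N n x
      = ∏ j : Fin n, (x - (T.orderEmbOfFin hcard j : ℂ)) := by
    have hqC : (q : ℂ) ≠ 0 := Complex.ofReal_ne_zero.2 hq0.ne'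
    have e1 : ((α / q : ℝ) : ℂ) * q = (α : ℂ) := by
      rw [← Complex.ofReal_mul, div_mul_cancel₀ _ hq0.ne']
    rw [qHahn_eq_eval hqC, e1]
    · have hmap := map_qHahnPoly Complex.ofRealHom q α B N n
      simp only [Complex.ofRealHom_eq_coe] at hmap
      rw [show ((α / q : ℝ) : ℂ) * ((β / q : ℝ) : ℂ) * (q : ℂ) ^ (n + 1) = (B : ℂ) by
        rw [hBdef]; push_cast; ring, ← hmap, hfac, Polynomial.map_prod, eval_prod]
      conv_lhs => rw [← image_orderEmbOfFin_univ T hcard]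
      rw [prod_image (T.orderEmbOfFin hcard).injective.injOn]
      simp
    · intro m
      rw [e1]
      have := map_qPoch Complex.ofRealHom α q m
      simp only [Complex.ofRealHom_eq_coe] at this
      rw [← this]
      exact Complex.ofReal_ne_zero.2 (hα0 m)
  refine ⟨T.orderEmbOfFin hcard, (T.orderEmbOfFin hcard).strictMono, hqHahn, fun x => ?_,
    fun h => ?_⟩
  · rw [hqHahn, prod_eq_zero_iff]
    simp [sub_eq_zero]
  · obtain ⟨⟨t, ht, ht1⟩, u, hu, hu1⟩ := hext h
    rw [orderEmbOfFin_zero hcard (by omega), orderEmbOfFin_last hcard (by omega), zpow_neg,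
      zpow_natCast]
    exact ⟨(min'_le T t ht).trans_lt ht1, hu1.trans_le (le_max' T u hu)⟩
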